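/- **Setting.** Let $\mathcal V,\mathcal H,\mathcal Q$ be real Hilbert spaces, where $\mathcal V\hookrightarrow\mathcal H\hookrightarrow\mathcal V^*$ is a Gelfand triple. Let $\mathcal B\in\mathcal L(\mathcal V,\mathcal Q^*)$ satisfy the inf-sup condition $\inf_{q\ne0}\sup_{v\neq0}\langle\mathcal Bv,q\rangle/(\|v\|_{\mathcal V}\|q\|_{\mathcal Q})\ge\beta>0$. Let $\mathcal A=\mathcal A_1+\mathcal A_2$ with $\mathcal A_1\in\mathcal L(\mathcal V,\mathcal V^*)$ self-adjoint and $\mathcal A_2\in\mathcal L(\mathcal V,\mathcal H)$, and let $\langle\mathcal Av,v\rangle\ge\mu\|v\|_{\mathcal V}^2$ on $\mathcal V_{\ker}=\ker\mathcal B$ with some $\mu>0$. Then $\mathcal B^-\colon\mathcal Q^*\to\mathcal V$ denotes the right-inverse of $\mathcal B$ with range $\{v\in\mathcal V:\langle\mathcal Av,w\rangle=0\ \forall w\in\mathcal V_{\ker}\}$. Let $T>0$ and let $f\colon[0,T]\times\mathcal V\to\mathcal H$ satisfy the following: $f(t,\cdot)$ is continuous for a.e. $t$ and $f(\cdot,v)$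 is measurable for all $v$; there is $k\in L^2(0,T)$ with $\|f(t,v)\|_{\mathcal H}\le k(t)(1+\|v\|_{\mathcal V})$ for all $v$ and a.e. $t$; every $v\in\mathcal V$ has an open ball $B_{r(v)}(v)$ and a constant $L(v)\ge0$ such that $f(t,\cdot)$ is $L(v)$-Lipschitz from $B_{r(v)}(v)\subset\mathcal V$ to $\mathcal H$ for a.e. $t$. Let $g\in H^2(0,T;\mathcal Q^*)$ and $u_0\in\mathcal V$ with $\mathcal Bu_0=g(0)$. Let $u\in C([0,T];\mathcal V)\cap H^1(0,T;\mathcal H)$, $\lambda\in L^2(0,T;\mathcal Q)$ be the solution of $$\dot u+\mathcal Au+\mathcal B^*\lambda=f(t,u)\ \text{ in }\mathcal V^*,\qquad \mathcal Bu=g\ \text{ in }\mathcal Q^*,\qquad u(0)=u_0 .$$ Assume that $t\mapsto f(t,u(t))$ is absolutely continuous on $[0,T]$ with values in $\mathcal H$ and $\frac{\mathrm d}{\mathrm dt}f(\cdot,u(\cdot))\in L^2(0,T;\mathcal H)$. **Scheme.** Let $N\ge1$, $\tau=T/N$, $t_n=n\tau$. Starting from $u_0$, for $n=0,\dots,N-1$: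 1. compute $\mathcal B^-g(t_n)$, $\mathcal B^-g(t_{n+1})$, $\mathcal B^-\dot g(t_n)$, where $x=\mathcal B^-q$ is the solution of $\mathcal Ax+\mathcal B^*\nu=0$, $\mathcal Bx=q$; 2. solve $\mathcal Aw_n+\mathcal B^*\nu_n=f(t_n,u_n)-\mathcal B^-\dot g(t_n)$, $\mathcal Bw_n=0$; 3. solve $\dot z+\mathcal Az+\mathcal B^*\eta=0$, $\mathcal Bz=0$ on $[t_n,t_{n+1}]$ with $z(t_n)=u_n-\mathcal B^-g(t_n)-w_n$, in the same solution class as above; 4. set $u_{n+1}=\mathcal B^-g(t_{n+1})+z(t_{n+1})+w_n$. **Theorem (Exponential Euler).** Let $\tau$ be small enough that the iterates stay in a strip along $u$ in which $f$ is uniformly Lipschitz, i.e. for some $r,L>0$: $\|u_n-u(t_n)\|_{\mathcal V}<r$ for $n=0,\dots,N$, and $\|f(t,v_1)-f(t,v_2)\|_{\mathcal H}\le L\|v_1-v_2\|_{\mathcal V}$ for all $v_1,v_2\in B_r(u(t))$, for a.e. $t\in[0,T]$ and for every grid point $t=t_0,\dots,t_N$. Then for all $n=0,\dots,N$ $$\|u_n-u(t_n)\|_{\mathcal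 V}^2\le C(t_n,L)\,\tau^2\int_0^{t_n}\Big(\big\|\tfrac{\mathrm d}{\mathrm dt}f(t,u(t))\big\|_{\mathcal H}^2+\|\mathcal B^-\ddot g(t)\|_{\mathcal H}^2\Big)\,\mathrm dt .$$ Here $C(t,L)$ is nondecreasing in $t$ and depends, besides $t$ and $L$, only on the operator $\mathcal A$ (with the Gelfand triple and the ellipticity constant $\mu$). In particular, the scheme converges with order one in $\mathcal V$, uniformly on the grid. -/

import Mathlib

open MeasureTheory Set

namespace ExpEuler

noncomputable section

/-- `u` is (the absolutely continuous representative of) an element of the Sobolev-Bochner space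
`H¹(a,b;X)` with generalized derivative `u'`: `u' ∈ L²(a,b;X)` and `u(t) = u(a) + ∫_a^t u'(s) ds`
for all `t ∈ [a,b]`. -/
def HasSobolevDeriv {X : Type*} [NormedAddCommGroup X] [NormedSpace ℝ X]
    (a b : ℝ) (u u' : ℝ → X) : Prop :=
  MemLp u' 2 (volume.restrict (Icc a b)) ∧ ∀ t ∈ Icc a b, u t = u a + ∫ s in a..t, u' s

section Spaces

variable {V H Q : Type*}
  [NormedAddCommGroup V] [InnerProductSpace ℝ V]
  [NormedAddCommGroup H] [InnerProductSpace ℝ H]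
  [NormedAddCommGroup Q] [InnerProductSpace ℝ Q]

/-- `V, H, V*` is a Gelfand triple with embedding `j : V → H`
(continuous, injective, with dense range). -/
def IsGelfandEmbedding (j : V →L[ℝ] H) : Prop :=
  Function.Injective j ∧ DenseRange j

/-- The embedding `H ≅ H* ↪ V*` of the Gelfand triple, `⟨h, v⟩ = (h, j v)_H`. -/
def toDual (j : V →L[ℝ] H) (h : H) : StrongDual ℝ V :=
  (innerSL ℝ h).comp j

/-- Inf-sup condition for the constraint operator `B : V → Q*`. -/
def InfSup (B : V →L[ℝ] StrongDual ℝ Q) : Prop :=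
  ∃ β : ℝ, 0 < β ∧ ∀ q : Q, q ≠ 0 →
    β ≤ ⨆ v : {v : V // v ≠ 0}, B v.1 q / (‖v.1‖ * ‖q‖)

/-- `A = A₁ + A₂` with `A₁ ∈ L(V,V*)` self-adjoint and `A₂ ∈ L(V,H)`. -/
def HasSplitting (j : V →L[ℝ] H) (A : V →L[ℝ] StrongDual ℝ V) : Prop :=
  ∃ (A₁ : V →L[ℝ] StrongDual ℝ V) (A₂ : V →L[ℝ] H),
    (∀ v w, A₁ v w = A₁ w v) ∧ ∀ v, A v = A₁ v + toDual j (A₂ v)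

/-- `A` is elliptic on `ker B` with ellipticity constant `μ`. -/
def EllipticOnKer (A : V →L[ℝ] StrongDual ℝ V) (B : V →L[ℝ] StrongDual ℝ Q) (μ : ℝ) : Prop :=
  0 < μ ∧ ∀ v : V, B v = 0 → μ * ‖v‖ ^ 2 ≤ A v v

/-- The complement `V_c = {v | ⟨A v, w⟩ = 0 for all w ∈ ker B}` of `ker B`. -/
def complementSpace (A : V →L[ℝ] StrongDual ℝ V) (B : V →L[ℝ] StrongDual ℝ Q) : Set V :=
  {v | ∀ w : V, B w = 0 → A v w = 0}

open Classical in
/-- The right-inverse `B⁻ : Q* → V` of `B` with range `V_c`: `B⁻ q` is the element `x` of `V_c` with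
`B x = q` (which exists and is unique if `B` is inf-sup stable and `A` is elliptic on `ker B`). -/
def rightInverse (A : V →L[ℝ] StrongDual ℝ V) (B : V →L[ℝ] StrongDual ℝ Q)
    (q : StrongDual ℝ Q) : V :=
  if h : ∃ x, x ∈ complementSpace A B ∧ B x = q then h.choose else 0

/-- `x` solves the stationary saddle point problem `A x + B* ν = ℓ` in `V*`, `B x = q` in `Q*`,
for some multiplier `ν ∈ Q`; here `B* = B.flip`, i.e. `⟨B* ν, v⟩ = ⟨B v, ν⟩`. -/
def SolvesSaddlePoint (A : V →L[ℝ] StrongDual ℝ V) (B : V →L[ℝ] StrongDual ℝ Q)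
    (ℓ : StrongDual ℝ V) (q : StrongDual ℝ Q) (x : V) : Prop :=
  ∃ ν : Q, A x + B.flip ν = ℓ ∧ B x = q

/-- `(u, lam)` solves on `[a,b]` the PDAE `u̇ + A u + B* lam = f(t,u)` in `V*`, `B u = g` in `Q*`,
`u(a) = u₀`, with `u ∈ C([a,b];V) ∩ H¹(a,b;H)` and `lam ∈ L²(a,b;Q)`. -/
structure IsPDAESolution (j : V →L[ℝ] H) (A : V →L[ℝ] StrongDual ℝ V)
    (B : V →L[ℝ] StrongDual ℝ Q) (f : ℝ → V → H) (g : ℝ → StrongDual ℝ Q)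
    (a b : ℝ) (u₀ : V) (u : ℝ → V) (lam : ℝ → Q) : Prop where
  continuousOn : ContinuousOn u (Icc a b)
  memLp_multiplier : MemLp lam 2 (volume.restrict (Icc a b))
  initial : u a = u₀
  dynamic : ∃ u' : ℝ → H, HasSobolevDeriv a b (fun t => j (u t)) u' ∧
    ∀ᵐ t ∂(volume.restrict (Icc a b)),
      toDual j (u' t) + A (u t) + B.flip (lam t) = toDual j (f t (u t))
  constraint : ∀ t ∈ Icc a b, B (u t) = g t

/-- Assumptions on the nonlinearity `f : [0,T] × V → H`: Carathéodory conditions, linear growth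
with an `L²` weight, and local Lipschitz continuity in the second argument. -/
structure NonlinearityAssumptions (T : ℝ) (f : ℝ → V → H) : Prop where
  continuous : ∀ᵐ t ∂(volume.restrict (Icc 0 T)), Continuous (f t)
  measurable : ∀ v : V, AEStronglyMeasurable (fun t => f t v) (volume.restrict (Icc 0 T))
  growth : ∃ k : ℝ → ℝ, MemLp k 2 (volume.restrict (Icc 0 T)) ∧
    ∀ v : V, ∀ᵐ t ∂(volume.restrict (Icc 0 T)), ‖f t v‖ ≤ k t * (1 + ‖v‖)
  locallyLipschitz : ∀ v : V, ∃ r : ℝ, 0 < r ∧ ∃ L : ℝ, 0 ≤ L ∧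
    ∀ᵐ t ∂(volume.restrict (Icc 0 T)), ∀ v₁ ∈ Metric.ball v r, ∀ v₂ ∈ Metric.ball v r,
      ‖f t v₁ - f t v₂‖ ≤ L * ‖v₁ - v₂‖

/-- At time `t`, the strip of radius `r` along `u` is one on which `f` is `L`-Lipschitz. -/
def LipschitzOnStripAt (f : ℝ → V → H) (u : ℝ → V) (r L t : ℝ) : Prop :=
  ∀ v₁ ∈ Metric.ball (u t) r, ∀ v₂ ∈ Metric.ball (u t) r, ‖f t v₁ - f t v₂‖ ≤ L * ‖v₁ - v₂‖

/-- One step of the exponential Euler scheme from `(s, y)` to `(s', y')`; `g'` is the time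
derivative of `g`. The vectors `x`, `x'`, `xd` are `B⁻ g(s)`, `B⁻ g(s')` and `B⁻ ġ(s)`, `w` solves
a stationary saddle point problem and `z` the homogeneous transient one on `[s,s']`. -/
def IsExpEulerStep (j : V →L[ℝ] H) (A : V →L[ℝ] StrongDual ℝ V)
    (B : V →L[ℝ] StrongDual ℝ Q) (f : ℝ → V → H) (g g' : ℝ → StrongDual ℝ Q)
    (s s' : ℝ) (y y' : V) : Prop :=
  ∃ (x x' xd w : V) (z : ℝ → V) (mult : ℝ → Q),
    SolvesSaddlePoint A B 0 (g s) x ∧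
    SolvesSaddlePoint A B 0 (g s') x' ∧
    SolvesSaddlePoint A B 0 (g' s) xd ∧
    SolvesSaddlePoint A B (toDual j (f s y - j xd)) 0 w ∧
    IsPDAESolution j A B (fun _ _ => 0) (fun _ => 0) s s' (y - x - w) z mult ∧
    y' = x' + z s' + w

/-- `U 0, …, U N` are produced by the exponential Euler scheme with step size `τ` and initial
value `u₀`. -/
def IsExpEulerApprox (j : V →L[ℝ] H) (A : V →L[ℝ] StrongDual ℝ V)
    (B : V →L[ℝ] StrongDual ℝ Q) (f : ℝ → V → H) (g g' : ℝ → StrongDual ℝ Q)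
    (τ : ℝ) (N : ℕ) (u₀ : V) (U : ℕ → V) : Prop :=
  U 0 = u₀ ∧ ∀ n < N, IsExpEulerStep j A B f g g' (n * τ) ((n + 1 : ℕ) * τ) (U n) (U (n + 1))

end Spaces

end

end ExpEuler

/-! On one step put `e(t) = u(t) - B⁻g(t) - z(t) - w`. This curve stays in `ker B` and joins the old
error `u(t_n) - u_n` to the new one. Since `A B⁻g` vanishes on `ker B`, testing with `ker B` removes
the multipliers and leaves `ė + A e = R`, where `R(t) = f(t,u(t)) - f(t_n,u_n) - B⁻(ġ(t) - ġ(t_n))`.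
By Cauchy-Schwarz in time and the Lipschitz condition at `t_n`, `‖R‖²` is at most `3τ` times the
integral of the data over the step plus `3L²‖u(t_n) - u_n‖²`.

Formally, testing with `ė` bounds the energy `E(v) = ⟨A₁ v, v⟩ + c‖v‖²_H`: `2‖ė‖²` absorbs all terms
containing `ė`, and `E' ≤ ‖R‖² + κE` remains. On `ker B` the energy dominates `μ/2 ‖v‖²_V`
(`EllipticOnKer.le_energy`), so the estimate holds in the norm of `V`. As `ė` need not take values
in `V`, the argument is run on Steklov averages of `e` (`energy_le_of_integral_eq_of_continuous`).

The resulting one-step bound `IsExpEulerStep.energy_error_le` carries local errors of size `τ²`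
times a local integral; these sum without loss of order, and a discrete Grönwall argument concludes.
-/

namespace ExpEuler

/-! ### Saddle point problems and the right-inverse of the constraint operator -/

section Stationary

variable {V Q : Type*}
  [NormedAddCommGroup V] [InnerProductSpace ℝ V]
  [NormedAddCommGroup Q] [InnerProductSpace ℝ Q]

/-- Lax-Milgram lemma for functionals. -/
theorem exists_of_isCoercive [CompleteSpace V] {b : V →L[ℝ] V →L[ℝ] ℝ} (hb : IsCoercive b) (ℓ : StrongDual ℝ V) :
    ∃ x, ∀ y, b x y = ℓ y := by
  refine ⟨hb.continuousLinearEquivOfBilin.symm ((InnerProductSpace.toDual ℝ V).symm ℓ), fun y => ?_⟩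
  rw [← hb.continuousLinearEquivOfBilin_apply]
  simp

/-- Lax-Milgram lemma on the kernel of the constraint operator. -/
theorem exists_mem_ker [CompleteSpace V] {A : V →L[ℝ] StrongDual ℝ V} {B : V →L[ℝ] StrongDual ℝ Q} {μ : ℝ}
    (hA : EllipticOnKer A B μ) (ℓ : StrongDual ℝ V) :
    ∃ x, B x = 0 ∧ ∀ w, B w = 0 → A x w = ℓ w := by
  let K : Submodule ℝ V := B.ker
  have hK : IsClosed (K : Set V) := B.isClosed_ker
  have : CompleteSpace K := hK.completeSpace_coe
  have hb : IsCoercive (A.bilinearComp K.subtypeL K.subtypeL) := by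
    refine ⟨μ, hA.1, fun v => ?_⟩
    have := hA.2 v.1 v.2
    simpa [sq, mul_assoc] using this
  obtain ⟨x, hx⟩ := exists_of_isCoercive hb (ℓ.comp K.subtypeL)
  exact ⟨x.1, x.2, fun w hw => by simpa using hx ⟨w, hw⟩⟩

/-- Each quotient in the supremum is at most `‖B* q‖ / ‖q‖`, so inf-sup stability bounds `B*` from
below. -/
theorem InfSup.exists_lower_bound {B : V →L[ℝ] StrongDual ℝ Q} (hB : InfSup B) :
    ∃ β : ℝ, 0 < β ∧ ∀ q : Q, β * ‖q‖ ≤ ‖B.flip q‖ := by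
  obtain ⟨β, hβ, h⟩ := hB
  refine ⟨β, hβ, fun q => ?_⟩
  rcases eq_or_ne q 0 with rfl | hq
  · simp
  have hq' : 0 < ‖q‖ := norm_pos_iff.mpr hq
  rw [← le_div_iff₀ hq']
  refine (h q hq).trans (Real.iSup_le (fun v => ?_) (by positivity))
  have hv : 0 < ‖v.1‖ := norm_pos_iff.mpr v.2
  rw [div_le_div_iff₀ (by positivity) hq']
  have := (le_abs_self _).trans ((B.flip q).le_opNorm v.1)
  rw [ContinuousLinearMap.flip_apply] at this
  nlinarith

/-- An inf-sup stable constraint operator is surjective. -/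
theorem InfSup.surjective [CompleteSpace V] [CompleteSpace Q] {B : V →L[ℝ] StrongDual ℝ Q} (hB : InfSup B) :
    Function.Surjective B := by
  obtain ⟨β, hβ, h⟩ := hB.exists_lower_bound
  -- `S` is `B*` followed by the Riesz map `V* → V`. The form `(S q, S p) = ⟨B S q, p⟩` is coercive
  -- with constant `β²`, so a preimage of `ℓ` can be sought in the range of `S`.
  let S : Q →L[ℝ] V := LinearMap.mkContinuous
    { toFun := fun q => (InnerProductSpace.toDual ℝ V).symm (B.flip q)
      map_add' := fun p q => by simp
      map_smul' := fun c q => by simp } ‖B.flip‖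
    fun q => by simpa using B.flip.le_opNorm q
  have hS : ∀ q v, inner ℝ (S q) v = B v q := fun q v => by
    simp [S]
  have hSn : ∀ q, ‖S q‖ = ‖B.flip q‖ := fun q => by simp [S]
  have hb : IsCoercive ((innerSL ℝ).bilinearComp S S) := by
    refine ⟨β ^ 2, by positivity, fun q => ?_⟩
    have h1 := h q
    rw [← hSn] at h1
    have h2 : 0 ≤ β * ‖q‖ := by positivity
    simp only [ContinuousLinearMap.bilinearComp_apply, innerSL_apply_apply,
      real_inner_self_eq_norm_sq]
    nlinarith
  intro ℓ
  obtain ⟨q, hq⟩ := exists_of_isCoercive hb ℓ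
  refine ⟨S q, ?_⟩
  ext p
  rw [← hS, real_inner_comm]
  simpa using hq p

/-- The difference lies in `ker B`, and `A` of it annihilates `ker B`; ellipticity leaves only zero.
-/
theorem eq_of_mem_complementSpace {A : V →L[ℝ] StrongDual ℝ V} {B : V →L[ℝ] StrongDual ℝ Q} {μ : ℝ}
    (hA : EllipticOnKer A B μ) {x y : V} (hx : x ∈ complementSpace A B)
    (hy : y ∈ complementSpace A B) (hxy : B x = B y) : x = y := by
  have hB : B (x - y) = 0 := by rw [map_sub, hxy, sub_self]
  have h1 := hA.2 _ hB
  have h2 : A (x - y) (x - y) = 0 := by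
    rw [map_sub A x y, sub_apply, hx _ hB, hy _ hB, sub_self]
  rw [h2] at h1
  have h3 : ‖x - y‖ ^ 2 ≤ 0 := by
    by_contra hc
    nlinarith [mul_pos hA.1 (not_le.mp hc)]
  exact sub_eq_zero.mp (norm_eq_zero.mp (by nlinarith [norm_nonneg (x - y)]))

/-- The right-inverse of the constraint operator is a bounded linear operator. -/
theorem exists_rightInverse_eq [CompleteSpace V] [CompleteSpace Q] {A : V →L[ℝ] StrongDual ℝ V} {B : V →L[ℝ] StrongDual ℝ Q} {μ : ℝ}
    (hA : EllipticOnKer A B μ) (hB : InfSup B) :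
    ∃ G : StrongDual ℝ Q →L[ℝ] V, (∀ q, G q ∈ complementSpace A B) ∧ (∀ q, B (G q) = q) ∧
      ∀ q, rightInverse A B q = G q := by
  let Vc : Submodule ℝ V :=
    { carrier := complementSpace A B
      add_mem' := fun {x y} hx hy w hw => by simp [hx w hw, hy w hw]
      zero_mem' := fun w _ => by simp
      smul_mem' := fun c x hx w hw => by simp [hx w hw] }
  have hcl : IsClosed (Vc : Set V) := by
    have : (Vc : Set V) = ⋂ w ∈ {w : V | B w = 0}, {v | A v w = 0} := by
      ext v
      simp [Vc, complementSpace]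
    rw [this]
    refine isClosed_biInter fun w _ => isClosed_eq ?_ continuous_const
    fun_prop
  have : CompleteSpace Vc := hcl.completeSpace_coe
  have hinj : (B.comp Vc.subtypeL).ker = ⊥ := by
    refine LinearMap.ker_eq_bot.mpr fun x y hxy => ?_
    exact Subtype.ext (eq_of_mem_complementSpace hA x.2 y.2 hxy)
  have hsurj : (B.comp Vc.subtypeL).range = ⊤ := by
    refine LinearMap.range_eq_top.mpr fun q => ?_
    obtain ⟨v, rfl⟩ := hB.surjective q
    -- Any preimage is moved into the complement by subtracting its `A`-projection onto `ker B`.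
    obtain ⟨x, hx, hxw⟩ := exists_mem_ker hA (A v)
    refine ⟨⟨v - x, fun w hw => by simp [hxw w hw]⟩, ?_⟩
    change B (v - x) = B v
    rw [map_sub, hx, sub_zero]
  -- The open mapping theorem supplies boundedness of the inverse.
  let Φ := ContinuousLinearEquiv.ofBijective (B.comp Vc.subtypeL) hinj hsurj
  have hΦ : ∀ q, B (Φ.symm q : V) = q := fun q => Φ.apply_symm_apply q
  refine ⟨Vc.subtypeL.comp (Φ.symm : StrongDual ℝ Q →L[ℝ] Vc), fun q => (Φ.symm q).2, hΦ,
    fun q => ?_⟩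
  have hex : ∃ x, x ∈ complementSpace A B ∧ B x = q := ⟨Φ.symm q, (Φ.symm q).2, hΦ q⟩
  rw [rightInverse, dif_pos hex]
  exact eq_of_mem_complementSpace hA hex.choose_spec.1 (Φ.symm q).2
    (hex.choose_spec.2.trans (hΦ q).symm)

theorem SolvesSaddlePoint.apply_of_ker {A : V →L[ℝ] StrongDual ℝ V} {B : V →L[ℝ] StrongDual ℝ Q}
    {ℓ : StrongDual ℝ V} {q : StrongDual ℝ Q} {x : V} (h : SolvesSaddlePoint A B ℓ q x)
    {v : V} (hv : B v = 0) : A x v = ℓ v := by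
  obtain ⟨ν, h1, -⟩ := h
  rw [← h1]
  simp [hv]

end Stationary

/-! ### Sobolev functions of time -/

section Calculus

/-- Cauchy-Schwarz inequality for the mean over an interval. -/
theorem sq_intervalIntegral_le {φ : ℝ → ℝ} {s t : ℝ} (hst : s ≤ t)
    (hφ : IntervalIntegrable φ volume s t)
    (hφ2 : IntervalIntegrable (fun x => φ x ^ 2) volume s t) :
    (∫ x in s..t, φ x) ^ 2 ≤ (t - s) * ∫ x in s..t, φ x ^ 2 := by
  rcases hst.eq_or_lt with rfl | hlt
  · simp
  set m := ∫ x in s..t, φ x with hm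
  have hpos : 0 < t - s := sub_pos.mpr hlt
  -- The integrand is the square of `φ` minus its mean, expanded.
  have h0 : 0 ≤ ∫ x in s..t, (φ x ^ 2 - (2 * (m / (t - s))) * φ x + (m / (t - s)) ^ 2) :=
    intervalIntegral.integral_nonneg hst fun x _ => by nlinarith [sq_nonneg (φ x - m / (t - s))]
  rw [intervalIntegral.integral_add (hφ2.sub (hφ.const_mul _)) intervalIntegrable_const,
    intervalIntegral.integral_sub hφ2 (hφ.const_mul _), intervalIntegral.integral_const_mul,
    intervalIntegral.integral_const, ← hm, smul_eq_mul] at h0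
  have h1 : (t - s) * (∫ x in s..t, φ x ^ 2) - m ^ 2 =
      (t - s) * ((∫ x in s..t, φ x ^ 2) - 2 * (m / (t - s)) * m + (t - s) * (m / (t - s)) ^ 2) := by
    field_simp
    ring
  have h2 := mul_nonneg hpos.le h0
  linarith

variable {X : Type*} [NormedAddCommGroup X] [NormedSpace ℝ X] {a b : ℝ} {u u' : ℝ → X}

theorem intervalIntegrable_of_Icc {X : Type*} [NormedAddCommGroup X] {a b : ℝ} {F : ℝ → X} (hF : IntegrableOn F (Icc a b)) {s t : ℝ}
    (hs : s ∈ Icc a b) (ht : t ∈ Icc a b) : IntervalIntegrable F volume s t :=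
  intervalIntegrable_iff.mpr (hF.mono_set (uIoc_subset_uIcc.trans (uIcc_subset_Icc hs ht)))

theorem HasSobolevDeriv.integrableOn (h : HasSobolevDeriv a b u u') :
    IntegrableOn u' (Icc a b) :=
  h.1.integrable one_le_two

theorem HasSobolevDeriv.integrableOn_sq (h : HasSobolevDeriv a b u u') :
    IntegrableOn (fun t => ‖u' t‖ ^ 2) (Icc a b) :=
  (memLp_two_iff_integrable_sq_norm h.1.1).mp h.1

theorem HasSobolevDeriv.sub_eq (h : HasSobolevDeriv a b u u') {s t : ℝ}
    (hs : s ∈ Icc a b) (ht : t ∈ Icc a b) : u t - u s = ∫ x in s..t, u' x := by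
  have ha : a ∈ Icc a b := left_mem_Icc.mpr (hs.1.trans hs.2)
  rw [h.2 t ht, h.2 s hs, add_sub_add_left_eq_sub,
    intervalIntegral.integral_interval_sub_left (intervalIntegrable_of_Icc h.integrableOn ha ht)
      (intervalIntegrable_of_Icc h.integrableOn ha hs)]

theorem HasSobolevDeriv.continuousOn (h : HasSobolevDeriv a b u u') :
    ContinuousOn u (Icc a b) :=
  (continuousOn_const.add (intervalIntegral.continuousOn_primitive_Icc h.integrableOn)).congr
    fun t ht => by
      simp only [Pi.add_apply]
      rw [h.2 t ht, intervalIntegral.integral_of_le ht.1, integral_Icc_eq_integral_Ioc]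

theorem HasSobolevDeriv.clm_comp [CompleteSpace X] {Y : Type*} [NormedAddCommGroup Y]
    [NormedSpace ℝ Y] [CompleteSpace Y] (h : HasSobolevDeriv a b u u') (G : X →L[ℝ] Y) :
    HasSobolevDeriv a b (fun t => G (u t)) (fun t => G (u' t)) := by
  refine ⟨G.comp_memLp' h.1, fun t ht => ?_⟩
  have ha : a ∈ Icc a b := left_mem_Icc.mpr (ht.1.trans ht.2)
  beta_reduce
  rw [h.2 t ht, map_add, G.intervalIntegral_comp_comm
    (intervalIntegrable_of_Icc h.integrableOn ha ht)]

/-- Hölder continuity of `H¹` functions. -/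
theorem HasSobolevDeriv.norm_sub_sq_le (h : HasSobolevDeriv a b u u') {s t t' : ℝ}
    (hs : s ∈ Icc a b) (ht' : t' ∈ Icc a b) (hst : s ≤ t) (htt : t ≤ t') :
    ‖u t - u s‖ ^ 2 ≤ (t' - s) * ∫ x in s..t', ‖u' x‖ ^ 2 := by
  have ht : t ∈ Icc a b := ⟨hs.1.trans hst, htt.trans ht'.2⟩
  have hn : ‖u t - u s‖ ≤ ∫ x in s..t, ‖u' x‖ := by
    rw [h.sub_eq hs ht]
    exact intervalIntegral.norm_integral_le_integral_norm hst
  calc ‖u t - u s‖ ^ 2 ≤ (∫ x in s..t, ‖u' x‖) ^ 2 := pow_le_pow_left₀ (norm_nonneg _) hn 2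
    _ ≤ (t - s) * ∫ x in s..t, ‖u' x‖ ^ 2 := sq_intervalIntegral_le hst
        (intervalIntegrable_of_Icc h.integrableOn.norm hs ht)
        (intervalIntegrable_of_Icc h.integrableOn_sq hs ht)
    _ ≤ (t' - s) * ∫ x in s..t', ‖u' x‖ ^ 2 := by
        refine mul_le_mul (by linarith) ?_ ?_ (by linarith)
        · exact intervalIntegral.integral_mono_interval le_rfl hst htt
            (Filter.Eventually.of_forall fun x => by positivity)
            (intervalIntegrable_of_Icc h.integrableOn_sq hs ht')
        · exact intervalIntegral.integral_nonneg hst fun x _ => by positivity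

end Calculus

/-! ### Energy estimate for smooth curves -/

section Energy

variable {V H Q : Type*}
  [NormedAddCommGroup V] [InnerProductSpace ℝ V]
  [NormedAddCommGroup H] [InnerProductSpace ℝ H]
  [NormedAddCommGroup Q] [InnerProductSpace ℝ Q]

/-- The energy `⟨A₁ v, v⟩ + c ‖v‖²_H`. -/
noncomputable def energy (j : V →L[ℝ] H) (A₁ : V →L[ℝ] StrongDual ℝ V) (c : ℝ) (v : V) : ℝ :=
  A₁ v v + c * ‖j v‖ ^ 2

theorem continuous_energy (j : V →L[ℝ] H) (A₁ : V →L[ℝ] StrongDual ℝ V) (c : ℝ) :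
    Continuous (energy j A₁ c) := by
  unfold energy
  fun_prop

/-- The energy estimate for classical solutions in the kernel of the constraint operator. -/
theorem energy_le_of_hasDerivAt {j : V →L[ℝ] H} {A A₁ : V →L[ℝ] StrongDual ℝ V} {A₂ : V →L[ℝ] H}
    (hsymm : ∀ v w, A₁ v w = A₁ w v) (hsplit : ∀ v, A v = A₁ v + toDual j (A₂ v))
    {B : V →L[ℝ] StrongDual ℝ Q} {c κ : ℝ} (hκ0 : 0 ≤ κ)
    (hκ : ∀ v, B v = 0 → ‖c • j v - A₂ v‖ ^ 2 ≤ κ * energy j A₁ c v)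
    {a b M : ℝ} (hab : a ≤ b) {e e' : ℝ → V} {R : ℝ → H}
    (hderiv : ∀ t ∈ Icc a b, HasDerivAt e (e' t) t)
    (he : ∀ t ∈ Icc a b, B (e t) = 0) (he' : ∀ t ∈ Icc a b, B (e' t) = 0)
    (hR : ∀ t ∈ Icc a b, ‖R t‖ ≤ M)
    (heq : ∀ t ∈ Icc a b, ∀ v, B v = 0 → inner ℝ (j v) (j (e' t)) + A (e t) v = inner ℝ (j v) (R t)) :
    energy j A₁ c (e b) ≤ Real.exp (κ * (b - a)) * (energy j A₁ c (e a) + (b - a) * M ^ 2) := by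
  let D : ℝ → ℝ := fun t => 2 * A₁ (e t) (e' t) + 2 * c * inner ℝ (j (e t)) (j (e' t))
  have hE : ∀ t ∈ Icc a b, HasDerivAt (fun t => energy j A₁ c (e t)) (D t) t := by
    intro t ht
    have h1 := hderiv t ht
    have h2 : HasDerivAt (fun t => A₁ (e t) (e t)) (A₁ (e' t) (e t) + A₁ (e t) (e' t)) t :=
      ((A₁.hasFDerivAt.comp_hasDerivAt t h1).clm_apply h1)
    have h3 := ((j.hasFDerivAt.comp_hasDerivAt t h1).norm_sq).const_mul c
    refine (h2.add h3).congr_deriv ?_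
    simp only [D, hsymm (e' t) (e t), Function.comp]
    ring
  have hD : ∀ t ∈ Icc a b, D t ≤ M ^ 2 + κ * energy j A₁ c (e t) := by
    intro t ht
    have h1 := heq t ht _ (he' t ht)
    rw [real_inner_comm (R t)] at h1
    have h2 : A (e t) (e' t) = A₁ (e t) (e' t) + inner ℝ (A₂ (e t)) (j (e' t)) := by
      rw [hsplit]
      simp [toDual]
    have h3 := hκ _ (he t ht)
    -- The equation tested with `e'` trades `A₁(e, e')` for terms that are inner products in `H`.
    have h4 : D t = 2 * inner ℝ (R t + (c • j (e t) - A₂ (e t))) (j (e' t))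
        - 2 * ‖j (e' t)‖ ^ 2 := by
      rw [inner_add_left, inner_sub_left, real_inner_smul_left, ← real_inner_self_eq_norm_sq]
      simp only [D]
      linarith
    have h5 := (real_inner_le_norm (R t + (c • j (e t) - A₂ (e t))) (j (e' t))).trans
      (mul_le_mul_of_nonneg_right (norm_add_le _ _) (norm_nonneg _))
    have h6 := hR t ht
    have h7 := pow_le_pow_left₀ (norm_nonneg _) h6 2
    -- Young: `2(p + q)x - 2x² ≤ (p + q)²/2 ≤ p² + q²`.
    nlinarith [sq_nonneg (‖R t‖ - ‖c • j (e t) - A₂ (e t)‖),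
      sq_nonneg (‖R t‖ + ‖c • j (e t) - A₂ (e t)‖ - 2 * ‖j (e' t)‖)]
  -- Grönwall with integrating factor; since that factor is at most `1`, subtracting `M²(t - a)`
  -- makes `ψ` nonincreasing.
  let ψ : ℝ → ℝ := fun t => Real.exp (-(κ * (t - a))) * energy j A₁ c (e t) - M ^ 2 * (t - a)
  have hψ : ∀ t ∈ Icc a b, HasDerivAt ψ
      (Real.exp (-(κ * (t - a))) * (D t - κ * energy j A₁ c (e t)) - M ^ 2) t := by
    intro t ht
    have h1 : HasDerivAt (fun t => -(κ * (t - a))) (-κ) t := by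
      have := ((hasDerivAt_id t).sub_const a).const_mul (-κ)
      simpa [neg_mul] using this
    have h2 : HasDerivAt (fun t => M ^ 2 * (t - a)) (M ^ 2) t := by
      simpa using ((hasDerivAt_id t).sub_const a).const_mul (M ^ 2)
    refine ((h1.exp.mul (hE t ht)).sub h2).congr_deriv ?_
    ring
  have hanti : AntitoneOn ψ (Icc a b) := by
    refine antitoneOn_of_deriv_nonpos (convex_Icc a b)
      (fun t ht => (hψ t ht).continuousAt.continuousWithinAt)
      (fun t ht => (hψ t (interior_subset ht)).differentiableAt.differentiableWithinAt)
      fun t ht => ?_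
    have ht' := interior_subset ht
    rw [(hψ t ht').deriv]
    have h1 : Real.exp (-(κ * (t - a))) ≤ 1 :=
      Real.exp_le_one_iff.mpr (neg_nonpos.mpr (mul_nonneg hκ0 (sub_nonneg.mpr ht'.1)))
    have h2 := hD t ht'
    have h3 : Real.exp (-(κ * (t - a))) * (D t - κ * energy j A₁ c (e t)) ≤
        Real.exp (-(κ * (t - a))) * M ^ 2 :=
      mul_le_mul_of_nonneg_left (by linarith) (Real.exp_pos _).le
    nlinarith [sq_nonneg M]
  have h := hanti (left_mem_Icc.mpr hab) (right_mem_Icc.mpr hab) hab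
  simp only [ψ, sub_self, mul_zero, Real.exp_zero, sub_zero, Real.exp_neg] at h
  have hpos := Real.exp_pos (κ * (b - a))
  have h8 : energy j A₁ c (e b) = Real.exp (κ * (b - a)) *
      ((Real.exp (κ * (b - a)))⁻¹ * energy j A₁ c (e b)) := by
    field_simp
  rw [h8]
  exact mul_le_mul_of_nonneg_left (by linarith) hpos.le

end Energy

/-! ### Energy estimate for weak solutions by Steklov averaging -/

section Averages

open Filter Topology

variable {V H Q : Type*}
  [NormedAddCommGroup V] [InnerProductSpace ℝ V]
  [NormedAddCommGroup H] [InnerProductSpace ℝ H] [CompleteSpace H]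
  [NormedAddCommGroup Q] [InnerProductSpace ℝ Q]

/-- The energy estimate for solutions of the integrated equation, by Steklov averaging in time. -/
theorem energy_le_of_integral_eq_of_continuous [CompleteSpace V]
    {j : V →L[ℝ] H} {A A₁ : V →L[ℝ] StrongDual ℝ V} {A₂ : V →L[ℝ] H}
    (hsymm : ∀ v w, A₁ v w = A₁ w v) (hsplit : ∀ v, A v = A₁ v + toDual j (A₂ v))
    {B : V →L[ℝ] StrongDual ℝ Q} {c κ : ℝ} (hκ0 : 0 ≤ κ)
    (hκ : ∀ v, B v = 0 → ‖c • j v - A₂ v‖ ^ 2 ≤ κ * energy j A₁ c v)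
    {a b M : ℝ} (hab : a < b) {e : ℝ → V} {R : ℝ → H}
    (hec : Continuous e) (hRc : Continuous R)
    (he : ∀ t, B (e t) = 0) (hR : ∀ t, ‖R t‖ ≤ M)
    (heq : ∀ s ∈ Icc a b, ∀ t ∈ Icc a b, ∀ v, B v = 0 →
      inner ℝ (j v) (j (e t) - j (e s)) + ∫ x in s..t, A (e x) v =
        ∫ x in s..t, inner ℝ (j v) (R x)) :
    energy j A₁ c (e b) ≤ Real.exp (κ * (b - a)) * (energy j A₁ c (e a) + (b - a) * M ^ 2) := by
  let P : ℝ → V := fun t => ∫ x in (0 : ℝ)..t, e x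
  have hP : ∀ t, HasDerivAt P (e t) t := fun t =>
    intervalIntegral.integral_hasDerivAt_right (hec.intervalIntegrable _ _)
      (hec.stronglyMeasurableAtFilter _ _) hec.continuousAt
  have hPsub : ∀ s t, P t - P s = ∫ x in s..t, e x := fun s t =>
    intervalIntegral.integral_interval_sub_left (hec.intervalIntegrable _ _)
      (hec.intervalIntegrable _ _)
  -- The mean of `e` over `[t, t + δ]`. Its derivative is a difference quotient of `e`, hence lies
  -- in `V` and in `ker B` and is an admissible test function. Averages look ahead by `δ`, so the
  -- estimate runs on `[a, b - δ]`.
  let η : ℝ → ℝ → V := fun δ t => δ⁻¹ • (P (t + δ) - P t)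
  have key : ∀ δ ∈ Ioo 0 (b - a), energy j A₁ c (η δ (b - δ)) ≤
      Real.exp (κ * ((b - δ) - a)) * (energy j A₁ c (η δ a) + ((b - δ) - a) * M ^ 2) := by
    intro δ hδ
    have hδ0 : 0 < δ := hδ.1
    refine energy_le_of_hasDerivAt hsymm hsplit hκ0 hκ (by linarith [hδ.2])
      (e' := fun t => δ⁻¹ • (e (t + δ) - e t)) (R := fun t => δ⁻¹ • ∫ x in t..t + δ, R x)
      (fun t _ => ?_) (fun t _ => ?_) (fun t _ => ?_) (fun t _ => ?_) (fun t ht v hv => ?_)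
    · exact (((hP (t + δ)).comp_add_const t δ).sub (hP t)).const_smul δ⁻¹
    · simp only [η, hPsub]
      rw [map_smul, ← B.intervalIntegral_comp_comm (hec.intervalIntegrable _ _)]
      simp [he]
    · simp [he]
    · have h1 := intervalIntegral.norm_integral_le_of_norm_le_const
        (a := t) (b := t + δ) (f := R) (C := M) fun x _ => hR x
      rw [add_sub_cancel_left, abs_of_pos hδ0] at h1
      rw [norm_smul, norm_inv, Real.norm_of_nonneg hδ0.le, inv_mul_le_iff₀ hδ0]
      linarith
    · have h1 := heq t ⟨ht.1, by linarith [ht.2]⟩ (t + δ)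
        ⟨by linarith [ht.1], by linarith [ht.2]⟩ v hv
      have h2 : A (∫ x in t..t + δ, e x) v = ∫ x in t..t + δ, A (e x) v :=
        ((A.flip v).intervalIntegral_comp_comm (hec.intervalIntegrable t (t + δ))).symm
      have h3 : inner ℝ (j v) (∫ x in t..t + δ, R x) = ∫ x in t..t + δ, inner ℝ (j v) (R x) :=
        ((innerSL ℝ (j v)).intervalIntegral_comp_comm (hRc.intervalIntegrable t (t + δ))).symm
      simp only [η, hPsub]
      rw [map_smul, map_smul, smul_apply, map_sub, inner_smul_right, inner_smul_right, h2, h3,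
        smul_eq_mul, ← mul_add, h1]
  have hlim : ∀ t, Tendsto (fun δ => η δ t) (𝓝[>] 0) (𝓝 (e t)) := fun t =>
    (hasDerivAt_iff_tendsto_slope_zero.mp (hP t)).mono_left
      (nhdsWithin_mono _ fun x hx => ne_of_gt hx)
  -- The last average covers `[b - δ, b]`: it is a backward difference quotient of `P` at `b`.
  have hlimb : Tendsto (fun δ => η δ (b - δ)) (𝓝[>] 0) (𝓝 (e b)) := by
    have h1 : Tendsto (fun δ : ℝ => -δ) (𝓝[>] 0) (𝓝[≠] 0) := by
      refine tendsto_nhdsWithin_iff.mpr ⟨?_, ?_⟩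
      · exact tendsto_nhdsWithin_of_tendsto_nhds (by simpa using (continuous_neg (G := ℝ)).tendsto 0)
      · filter_upwards [self_mem_nhdsWithin] with δ hδ
        simpa using ne_of_gt hδ
    refine ((hasDerivAt_iff_tendsto_slope_zero.mp (hP b)).comp h1).congr fun δ => ?_
    simp only [Function.comp, η, sub_add_cancel, ← sub_eq_add_neg, inv_neg, neg_smul, ← smul_neg,
      neg_sub]
  have hE := continuous_energy j A₁ c
  have hid : Tendsto (fun δ : ℝ => (b - δ) - a) (𝓝[>] 0) (𝓝 (b - a)) :=
    tendsto_nhdsWithin_of_tendsto_nhds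
      (by simpa using (by fun_prop : Continuous fun δ : ℝ => (b - δ) - a).tendsto 0)
  refine le_of_tendsto_of_tendsto ((hE.tendsto _).comp hlimb)
    (((Real.continuous_exp.tendsto _).comp (hid.const_mul κ)).mul
      (((hE.tendsto _).comp (hlim a)).add (hid.mul_const (M ^ 2)))) ?_
  filter_upwards [Ioo_mem_nhdsGT (sub_pos.mpr hab)] with δ hδ using key δ hδ

/-- The energy estimate for solutions of the integrated equation. -/
theorem energy_le_of_integral_eq [CompleteSpace V]
    {j : V →L[ℝ] H} {A A₁ : V →L[ℝ] StrongDual ℝ V} {A₂ : V →L[ℝ] H}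
    (hsymm : ∀ v w, A₁ v w = A₁ w v) (hsplit : ∀ v, A v = A₁ v + toDual j (A₂ v))
    {B : V →L[ℝ] StrongDual ℝ Q} {c κ : ℝ} (hκ0 : 0 ≤ κ)
    (hκ : ∀ v, B v = 0 → ‖c • j v - A₂ v‖ ^ 2 ≤ κ * energy j A₁ c v)
    {a b M : ℝ} (hab : a < b) {e : ℝ → V} {R : ℝ → H}
    (hec : ContinuousOn e (Icc a b)) (hRc : ContinuousOn R (Icc a b))
    (he : ∀ t ∈ Icc a b, B (e t) = 0) (hR : ∀ t ∈ Icc a b, ‖R t‖ ≤ M)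
    (heq : ∀ s ∈ Icc a b, ∀ t ∈ Icc a b, ∀ v, B v = 0 →
      inner ℝ (j v) (j (e t) - j (e s)) + ∫ x in s..t, A (e x) v =
        ∫ x in s..t, inner ℝ (j v) (R x)) :
    energy j A₁ c (e b) ≤ Real.exp (κ * (b - a)) * (energy j A₁ c (e a) + (b - a) * M ^ 2) := by
  -- Composition with the projection onto `[a,b]` extends `e` and `R` by constants, preserving
  -- continuity and all bounds.
  let p : ℝ → ℝ := fun t => projIcc a b hab.le t
  have hp : Continuous p := continuous_subtype_val.comp continuous_projIcc
  have hpm : ∀ t, p t ∈ Icc a b := fun t => (projIcc a b hab.le t).2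
  have hpe : ∀ t ∈ Icc a b, p t = t := fun t ht => by simp only [p, projIcc_of_mem hab.le ht]
  have h := energy_le_of_integral_eq_of_continuous hsymm hsplit hκ0 hκ hab (e := e ∘ p) (R := R ∘ p)
    (hec.comp_continuous hp hpm) (hRc.comp_continuous hp hpm)
    (fun t => he _ (hpm t)) (fun t => hR _ (hpm t)) fun s hs t ht v hv => by
      have h1 := heq s hs t ht v hv
      have hsub : ∀ x ∈ uIcc s t, p x = x := fun x hx => hpe x (uIcc_subset_Icc hs ht hx)
      simp only [Function.comp, hpe s hs, hpe t ht]
      rw [intervalIntegral.integral_congr (g := fun x => A (e x) v) fun x hx => by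
          simp only [hsub x hx], h1]
      exact intervalIntegral.integral_congr fun x hx => by simp only [hsub x hx]
  simpa only [Function.comp, hpe a (left_mem_Icc.mpr hab.le),
    hpe b (right_mem_Icc.mpr hab.le)] using h

/-- The PDAE tested with elements of `ker B` and integrated in time. -/
theorem IsPDAESolution.integral_eq {j : V →L[ℝ] H} {A : V →L[ℝ] StrongDual ℝ V}
    {B : V →L[ℝ] StrongDual ℝ Q} {f : ℝ → V → H} {g : ℝ → StrongDual ℝ Q} {a b : ℝ} {u₀ : V}
    {u : ℝ → V} {lam : ℝ → Q} (h : IsPDAESolution j A B f g a b u₀ u lam)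
    {s t : ℝ} (hs : s ∈ Icc a b) (ht : t ∈ Icc a b) {v : V} (hv : B v = 0) :
    inner ℝ (j v) (j (u t) - j (u s)) + ∫ x in s..t, A (u x) v =
      ∫ x in s..t, inner ℝ (j v) (f x (u x)) := by
  obtain ⟨u', hu', hdyn⟩ := h.dynamic
  have hA : IntervalIntegrable (fun x => A (u x) v) volume s t := by
    refine ContinuousOn.intervalIntegrable (ContinuousOn.mono ?_ (uIcc_subset_Icc hs ht))
    exact (A.flip v).continuous.comp_continuousOn h.continuousOn
  have hi := intervalIntegrable_of_Icc hu'.integrableOn hs ht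
  have hI : IntervalIntegrable (fun x => inner ℝ (j v) (u' x)) volume s t :=
    ⟨hi.1.const_inner (j v), hi.2.const_inner (j v)⟩
  have h1 : inner ℝ (j v) (j (u t) - j (u s)) = ∫ x in s..t, inner ℝ (j v) (u' x) := by
    rw [hu'.sub_eq hs ht]
    exact ((innerSL ℝ (j v)).intervalIntegral_comp_comm hi).symm
  rw [h1, ← intervalIntegral.integral_add hI hA]
  refine intervalIntegral.integral_congr_ae ?_
  rw [ae_restrict_iff' measurableSet_Icc] at hdyn
  filter_upwards [hdyn] with x hx hxm
  have h2 := congrArg (fun φ : StrongDual ℝ V => φ v)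
    (hx (uIcc_subset_Icc hs ht (uIoc_subset_uIcc hxm)))
  simpa [toDual, hv, real_inner_comm] using h2

end Averages

/-! ### Error propagation over one step -/

section ErrorEstimate

variable {V H Q : Type*}
  [NormedAddCommGroup V] [InnerProductSpace ℝ V] [CompleteSpace V]
  [NormedAddCommGroup H] [InnerProductSpace ℝ H] [CompleteSpace H]
  [NormedAddCommGroup Q] [InnerProductSpace ℝ Q]

/-- Propagation of the error, measured in the energy, by one step of the exponential Euler
scheme. -/
theorem IsExpEulerStep.energy_error_le
    {j : V →L[ℝ] H} {A A₁ : V →L[ℝ] StrongDual ℝ V} {A₂ : V →L[ℝ] H}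
    (hsymm : ∀ v w, A₁ v w = A₁ w v) (hsplit : ∀ v, A v = A₁ v + toDual j (A₂ v))
    {B : V →L[ℝ] StrongDual ℝ Q} {μ c κ : ℝ} (hA : EllipticOnKer A B μ) (hκ0 : 0 ≤ κ)
    (hκ : ∀ v, B v = 0 → ‖c • j v - A₂ v‖ ^ 2 ≤ κ * energy j A₁ c v)
    {G : StrongDual ℝ Q →L[ℝ] V} (hG : ∀ q, G q ∈ complementSpace A B) (hBG : ∀ q, B (G q) = q)
    {T : ℝ} {f : ℝ → V → H} {g g' g'' : ℝ → StrongDual ℝ Q}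
    (hg : HasSobolevDeriv 0 T g g') (hg' : HasSobolevDeriv 0 T g' g'')
    {u₀ : V} {u : ℝ → V} {lam : ℝ → Q} (hu : IsPDAESolution j A B f g 0 T u₀ u lam)
    {F' : ℝ → H} (hF : HasSobolevDeriv 0 T (fun t => f t (u t)) F')
    {s s' : ℝ} (hs : s ∈ Icc 0 T) (hs' : s' ∈ Icc 0 T) (hss : s < s')
    {y y' : V} (hstep : IsExpEulerStep j A B f g g' s s' y y')
    {L : ℝ} (hL : ‖f s (u s) - f s y‖ ≤ L * ‖u s - y‖) :
    energy j A₁ c (u s' - y') ≤ Real.exp (κ * (s' - s)) * (energy j A₁ c (u s - y) +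
      (s' - s) * (3 * ((s' - s) * (∫ x in s..s', (‖F' x‖ ^ 2 + ‖j (G (g'' x))‖ ^ 2)) +
        L ^ 2 * ‖u s - y‖ ^ 2))) := by
  obtain ⟨x, x', xd, w, z, mult, hx, hx', hxd, hw, hz, rfl⟩ := hstep
  have hGeq : ∀ {q : StrongDual ℝ Q} {v : V}, SolvesSaddlePoint A B 0 q v → v = G q :=
    fun {q v} h => eq_of_mem_complementSpace hA (fun w hw => by simpa using h.apply_of_ker hw)
      (hG q) (by rw [hBG]; exact h.choose_spec.2)
  have hsub : Icc s s' ⊆ Icc 0 T := Icc_subset_Icc hs.1 hs'.2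
  have hBw : B w = 0 := hw.choose_spec.2
  obtain rfl := hGeq hx
  obtain rfl := hGeq hx'
  obtain rfl := hGeq hxd
  -- `G (g t)` carries the constraint and `w` the frozen right-hand side, so `e` solves a
  -- homogeneous-constraint problem whose forcing `R` is the consistency error.
  let e : ℝ → V := fun t => u t - G (g t) - z t - w
  let R : ℝ → H := fun t => f t (u t) - j (G (g' t)) - (f s y - j (G (g' s)))
  have hJg := hg.clm_comp (j.comp G)
  have hJg' := hg'.clm_comp (j.comp G)
  have hfc : ContinuousOn (fun t => f t (u t)) (Icc 0 T) := hF.continuousOn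
  set I := ∫ x in s..s', (‖F' x‖ ^ 2 + ‖j (G (g'' x))‖ ^ 2)
  -- The factor `3` comes from `(p + q + l)² ≤ 3(p² + q² + l²)`: variation of `f(·,u)`, variation of
  -- `j G g'`, and the Lipschitz term.
  set M2 := 3 * ((s' - s) * I + L ^ 2 * ‖u s - y‖ ^ 2) with hM2
  have hRM : ∀ t ∈ Icc s s', ‖R t‖ ^ 2 ≤ M2 := by
    intro t ht
    have h1 := hF.norm_sub_sq_le hs hs' ht.1 ht.2
    have h2 := hJg'.norm_sub_sq_le hs hs' ht.1 ht.2
    have h3 : I = (∫ x in s..s', ‖F' x‖ ^ 2) + ∫ x in s..s', ‖(j.comp G) (g'' x)‖ ^ 2 :=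
      intervalIntegral.integral_add (intervalIntegrable_of_Icc hF.integrableOn_sq hs hs')
        (intervalIntegrable_of_Icc hJg'.integrableOn_sq hs hs')
    have h4 : R t = (f t (u t) - f s (u s)) - ((j.comp G) (g' t) - (j.comp G) (g' s)) +
        (f s (u s) - f s y) := by
      simp only [R, ContinuousLinearMap.comp_apply]
      abel
    have h5 := (norm_add_le ((f t (u t) - f s (u s)) - ((j.comp G) (g' t) - (j.comp G) (g' s)))
      (f s (u s) - f s y)).trans (add_le_add_left (norm_sub_le _ _) _)
    rw [← h4] at h5
    have h6 := pow_le_pow_left₀ (norm_nonneg _) hL 2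
    have h7 := pow_le_pow_left₀ (norm_nonneg _) h5 2
    rw [mul_pow] at h6
    rw [hM2, h3, mul_add]
    refine h7.trans ?_
    set p := ‖f t (u t) - f s (u s)‖
    set q := ‖(j.comp G) (g' t) - (j.comp G) (g' s)‖
    set l := ‖f s (u s) - f s y‖
    nlinarith [sq_nonneg (p - q), sq_nonneg (q - l), sq_nonneg (p - l)]
  have hM0 : 0 ≤ M2 := (sq_nonneg _).trans (hRM s (left_mem_Icc.mpr hss.le))
  have hes : e s = u s - y := by
    simp only [e, hz.initial]
    abel
  have hes' : e s' = u s' - (G (g s') + z s' + w) := by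
    simp only [e]
    abel
  have main := energy_le_of_integral_eq hsymm hsplit hκ0 hκ hss (e := e) (R := R)
    (M := Real.sqrt M2) ?_ ?_ ?_ ?_ ?_
  · rwa [hes, hes', Real.sq_sqrt hM0] at main
  · exact (((hu.continuousOn.mono hsub).sub
      (G.continuous.comp_continuousOn (hg.continuousOn.mono hsub))).sub hz.continuousOn).sub
      continuousOn_const
  · exact ((hfc.mono hsub).sub (hJg'.continuousOn.mono hsub)).sub continuousOn_const
  · intro t ht
    simp [e, hu.constraint t (hsub ht), hz.constraint t ht, hBG, hBw]
  · exact fun t ht => Real.le_sqrt_of_sq_le (hRM t ht)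
  -- The integrated equations of `u` and `z` are subtracted; `A (G (g x))` vanishes on `ker B`,
  -- while `A w` contributes exactly the forcing frozen at `s`.
  · intro a ha b hb v hv
    have h1 := hu.integral_eq (hsub ha) (hsub hb) hv
    have h2 := hz.integral_eq ha hb hv
    have h3 := hJg.sub_eq (hsub ha) (hsub hb)
    have hab : uIcc a b ⊆ Icc s s' := uIcc_subset_Icc ha hb
    have hAu : IntervalIntegrable (fun x => A (u x) v) volume a b :=
      (((A.flip v).continuous.comp_continuousOn hu.continuousOn).mono
        (hab.trans hsub)).intervalIntegrable
    have hAz : IntervalIntegrable (fun x => A (z x) v) volume a b :=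
      (((A.flip v).continuous.comp_continuousOn hz.continuousOn).mono hab).intervalIntegrable
    have hf : IntervalIntegrable (fun x => inner ℝ (j v) (f x (u x))) volume a b :=
      ((continuousOn_const.inner hfc).mono (hab.trans hsub)).intervalIntegrable
    have hg1 : IntervalIntegrable (fun x => inner ℝ (j v) (j (G (g' x)))) volume a b :=
      ((continuousOn_const.inner hJg'.continuousOn).mono (hab.trans hsub)).intervalIntegrable
    have h4 : ∫ x in a..b, A (e x) v = (∫ x in a..b, A (u x) v) - (∫ x in a..b, A (z x) v) -
        (b - a) * A w v := by
      have : ∀ x, A (e x) v = A (u x) v - A (z x) v - A w v := fun x => by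
        simp [e, hG (g x) v hv]
      simp only [this]
      rw [intervalIntegral.integral_sub (hAu.sub hAz) intervalIntegrable_const,
        intervalIntegral.integral_sub hAu hAz, intervalIntegral.integral_const, smul_eq_mul]
    have h5 : ∫ x in a..b, inner ℝ (j v) (R x) = (∫ x in a..b, inner ℝ (j v) (f x (u x))) -
        (∫ x in a..b, inner ℝ (j v) (j (G (g' x)))) -
        (b - a) * inner ℝ (j v) (f s y - j (G (g' s))) := by
      simp only [R, inner_sub_right _ (_ - _) (_ - _)]
      simp only [inner_sub_right _ (f _ (u _)) _]
      rw [intervalIntegral.integral_sub (hf.sub hg1) intervalIntegrable_const,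
        intervalIntegral.integral_sub hf hg1, intervalIntegral.integral_const, smul_eq_mul]
    have h6 : inner ℝ (j v) (j (G (g b)) - j (G (g a))) =
        ∫ x in a..b, inner ℝ (j v) (j (G (g' x))) := by
      have := ((innerSL ℝ (j v)).intervalIntegral_comp_comm
        (intervalIntegrable_of_Icc hJg.integrableOn (hsub ha) (hsub hb))).symm
      rw [← h3] at this
      exact this
    have h7 : A w v = inner ℝ (j v) (f s y - j (G (g' s))) := by
      rw [hw.apply_of_ker hv, real_inner_comm]
      rfl
    have h8 : j (e b) - j (e a) = (j (u b) - j (u a)) - (j (G (g b)) - j (G (g a))) -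
        (j (z b) - j (z a)) := by
      simp only [e, map_sub]
      abel
    simp only [inner_zero_right, intervalIntegral.integral_zero] at h2
    rw [h8, inner_sub_right, inner_sub_right, h4, h5, h6, h7]
    linarith

/-- The energy is coercive on `ker B`. -/
theorem EllipticOnKer.le_energy {V H Q : Type*} [NormedAddCommGroup V] [InnerProductSpace ℝ V]
    [NormedAddCommGroup H] [InnerProductSpace ℝ H] [NormedAddCommGroup Q] [InnerProductSpace ℝ Q]
    {j : V →L[ℝ] H} {A A₁ : V →L[ℝ] StrongDual ℝ V}
    {A₂ : V →L[ℝ] H} (hsplit : ∀ v, A v = A₁ v + toDual j (A₂ v))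
    {B : V →L[ℝ] StrongDual ℝ Q} {μ : ℝ} (hA : EllipticOnKer A B μ) {v : V} (hv : B v = 0) :
    μ / 2 * ‖v‖ ^ 2 ≤ energy j A₁ (‖A₂‖ ^ 2 / (2 * μ)) v := by
  have hμ := hA.1
  have h1 := hA.2 v hv
  have h2 : A v v = A₁ v v + inner ℝ (A₂ v) (j v) := by
    rw [hsplit]
    simp [toDual]
  have h3 : inner ℝ (A₂ v) (j v) ≤ ‖A₂‖ * ‖v‖ * ‖j v‖ :=
    (real_inner_le_norm _ _).trans (mul_le_mul_of_nonneg_right (A₂.le_opNorm v) (norm_nonneg _))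
  -- Completing this square is what fixes the weight `‖A₂‖² / (2μ)` in the energy.
  have h4 : 0 ≤ μ / 2 * (‖v‖ - ‖A₂‖ / μ * ‖j v‖) ^ 2 := by positivity
  have h5 : μ / 2 * (‖v‖ - ‖A₂‖ / μ * ‖j v‖) ^ 2 = μ / 2 * ‖v‖ ^ 2 - ‖A₂‖ * ‖v‖ * ‖j v‖ +
      ‖A₂‖ ^ 2 / (2 * μ) * ‖j v‖ ^ 2 := by
    field_simp
    ring
  unfold energy
  linarith

end ErrorEstimate

end ExpEuler

/-! ### Discrete Grönwall argument -/

theorem mainTheorem2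
    {V H : Type*}
    [NormedAddCommGroup V] [InnerProductSpace ℝ V] [CompleteSpace V]
    [NormedAddCommGroup H] [InnerProductSpace ℝ H] [CompleteSpace H]
    (j : V →L[ℝ] H) (hj : ExpEuler.IsGelfandEmbedding j)
    (A : V →L[ℝ] StrongDual ℝ V) (hA : ExpEuler.HasSplitting j A) (μ : ℝ) :
    -- the constant depends on `t_n`, `L`, and `A` with its ellipticity constant only
    ∃ C : ℝ → ℝ → ℝ, (∀ L : ℝ, Monotone fun t => C t L) ∧
    ∀ (Q : Type*) [NormedAddCommGroup Q] [InnerProductSpace ℝ Q] [CompleteSpace Q]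
      (B : V →L[ℝ] StrongDual ℝ Q) (_ : ExpEuler.InfSup B) (_ : ExpEuler.EllipticOnKer A B μ)
      (T : ℝ) (_ : 0 < T) (f : ℝ → V → H) (_ : ExpEuler.NonlinearityAssumptions T f)
      -- `g ∈ H²(0,T;Q*)` with derivatives `g'`, `g''`
      (g g' g'' : ℝ → StrongDual ℝ Q)
      (_ : ExpEuler.HasSobolevDeriv 0 T g g') (_ : ExpEuler.HasSobolevDeriv 0 T g' g'')
      (u₀ : V) (_ : B u₀ = g 0)
      -- the exact solution, with `F'` the derivative of `f(·,u(·))` in `L²(0,T;H)`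
      (u : ℝ → V) (lam : ℝ → Q) (_ : ExpEuler.IsPDAESolution j A B f g 0 T u₀ u lam)
      (F' : ℝ → H) (_ : ExpEuler.HasSobolevDeriv 0 T (fun t => f t (u t)) F')
      -- the approximation on the uniform grid `t_n = n τ`
      (N : ℕ) (_ : 0 < N) (τ : ℝ) (_ : τ = T / N)
      (U : ℕ → V) (_ : ExpEuler.IsExpEulerApprox j A B f g g' τ N u₀ U)
      -- the approximation stays in a strip along `u` in which `f` is Lipschitz with constant `L`
      (r L : ℝ) (_ : 0 < r) (_ : 0 < L)
      (_ : ∀ᵐ t ∂(MeasureTheory.volume.restrict (Set.Icc 0 T)),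
        ExpEuler.LipschitzOnStripAt f u r L t)
      (_ : ∀ n ≤ N, ExpEuler.LipschitzOnStripAt f u r L (n * τ))
      (_ : ∀ n ≤ N, U n ∈ Metric.ball (u (n * τ)) r),
      ∀ n ≤ N, ‖U n - u (n * τ)‖ ^ 2 ≤
        C (n * τ) L * τ ^ 2 *
          ∫ t in (0 : ℝ)..(n * τ),
            (‖F' t‖ ^ 2 + ‖j (ExpEuler.rightInverse A B (g'' t))‖ ^ 2) := by
  -- `C` is chosen before ellipticity is assumed, so the sign of `μ` is not yet known; for `μ ≤ 0`
  -- the claim is vacuous.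
  rcases le_or_gt μ 0 with hμ | hμ
  · exact ⟨fun _ _ => 0, fun _ => monotone_const, fun Q _ _ _ B _ hell =>
      absurd hell.1 (not_lt.mpr hμ)⟩
  obtain ⟨A₁, A₂, hsymm, hsplit⟩ := hA
  set c := ‖A₂‖ ^ 2 / (2 * μ)
  set κ := 2 * ‖c • j - A₂‖ ^ 2 / μ with hκdef
  have hκ0 : 0 ≤ κ := by positivity
  -- Here `6/μ` is the factor `3` of the one-step bound times `2/μ` from coercivity; `κ` is the
  -- energy growth rate and `6L²/μ` the Lipschitz feedback of the error.
  refine ⟨fun t L => 6 / μ * Real.exp ((κ + 6 * L ^ 2 / μ) * t), fun L s t hst => ?_, ?_⟩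
  · exact mul_le_mul_of_nonneg_left (Real.exp_le_exp.mpr
      (mul_le_mul_of_nonneg_left hst (by positivity))) (by positivity)
  intro Q _ _ _ B hB hell T hT f _ g g' g'' hg hg' u₀ _ u lam hu F' hF N hN τ hτ U hU r L hr _ _
    hLip hball
  obtain ⟨G, hG, hBG, hGr⟩ := ExpEuler.exists_rightInverse_eq hell hB
  simp only [hGr]
  have hN' : (0 : ℝ) < N := Nat.cast_pos.mpr hN
  have hτ0 : 0 < τ := hτ ▸ div_pos hT hN'
  have hgrid : ∀ n : ℕ, n ≤ N → (n : ℝ) * τ ∈ Icc 0 T := fun n hn => by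
    refine ⟨by positivity, ?_⟩
    have h1 : (N : ℝ) * τ = T := by
      rw [hτ]
      field_simp
    rw [← h1]
    exact mul_le_mul_of_nonneg_right (Nat.cast_le.mpr hn) hτ0.le
  -- The scheme meets the constraint exactly at grid points, so the errors stay where the energy is
  -- coercive.
  have hBe : ∀ n ≤ N, B (u (n * τ) - U n) = 0 := by
    intro n hn
    rw [map_sub, hu.constraint _ (hgrid n hn), sub_eq_zero]
    rcases n with _ | n
    · rw [hU.1, ← hu.initial, hu.constraint 0 ⟨le_rfl, hT.le⟩]
      simp
    · obtain ⟨x, x', xd, w, z, mult, -, hx', -, hw, hz, h⟩ := hU.2 n hn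
      have hz' := hz.constraint ((n + 1 : ℕ) * τ) (right_mem_Icc.mpr
        (mul_le_mul_of_nonneg_right (by exact_mod_cast n.le_succ) hτ0.le))
      rw [h, map_add, map_add, hx'.choose_spec.2, hz', hw.choose_spec.2, add_zero, add_zero]
  have hcoer : ∀ v, B v = 0 → μ / 2 * ‖v‖ ^ 2 ≤ ExpEuler.energy j A₁ c v := fun v hv =>
    hell.le_energy hsplit hv
  have hκ : ∀ v, B v = 0 → ‖c • j v - A₂ v‖ ^ 2 ≤ κ * ExpEuler.energy j A₁ c v := by
    intro v hv
    have h1 : ‖c • j v - A₂ v‖ ≤ ‖c • j - A₂‖ * ‖v‖ := (c • j - A₂).le_opNorm v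
    calc ‖c • j v - A₂ v‖ ^ 2 ≤ (‖c • j - A₂‖ * ‖v‖) ^ 2 := pow_le_pow_left₀ (norm_nonneg _) h1 2
      _ = κ * (μ / 2 * ‖v‖ ^ 2) := by
        rw [hκdef]
        field_simp
      _ ≤ _ := mul_le_mul_of_nonneg_left (hcoer v hv) hκ0
  let ρ : ℝ → ℝ := fun t => ‖F' t‖ ^ 2 + ‖j (G (g'' t))‖ ^ 2
  have hρ : IntegrableOn ρ (Icc 0 T) :=
    hF.integrableOn_sq.add (hg'.clm_comp (j.comp G)).integrableOn_sq
  set θ := κ + 6 * L ^ 2 / μ with hθ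
  have key : ∀ n ≤ N, ExpEuler.energy j A₁ c (u (n * τ) - U n) ≤
      3 * τ ^ 2 * Real.exp (θ * (n * τ)) * ∫ t in (0 : ℝ)..(n * τ), ρ t := by
    intro n
    induction n with
    | zero => simp [hU.1, hu.initial, ExpEuler.energy]
    | succ n ih =>
      intro hn
      have hn0 : n ≤ N := n.le_succ.trans hn
      have ih := ih hn0
      have hL := hLip n hn0 _ (Metric.mem_ball_self hr) _ (hball n hn0)
      have hd : ((n + 1 : ℕ) : ℝ) * τ - n * τ = τ := by
        push_cast
        ring
      have h1 := (hU.2 n hn).energy_error_le hsymm hsplit hell hκ0 hκ hG hBG hg hg' hu hF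
        (hgrid n hn0) (hgrid _ hn) (by linarith) hL
      rw [hd] at h1
      have h2 := hcoer _ (hBe n hn0)
      have h3 : ∫ t in (0 : ℝ)..((n + 1 : ℕ) * τ), ρ t =
          (∫ t in (0 : ℝ)..(n * τ), ρ t) + ∫ t in (n * τ)..((n + 1 : ℕ) * τ), ρ t :=
        (intervalIntegral.integral_add_adjacent_intervals
          (ExpEuler.intervalIntegrable_of_Icc hρ ⟨le_rfl, hT.le⟩ (hgrid n hn0))
          (ExpEuler.intervalIntegrable_of_Icc hρ (hgrid n hn0) (hgrid _ hn))).symm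
      have h4 : 0 ≤ ∫ t in (n * τ)..((n + 1 : ℕ) * τ), ρ t :=
        intervalIntegral.integral_nonneg (by linarith) fun t _ => by positivity
      rw [h3]
      change _ ≤ Real.exp (κ * τ) * (_ + τ * (3 * (τ * (∫ t in (n * τ)..((n + 1 : ℕ) * τ), ρ t) +
        _))) at h1
      set E := ExpEuler.energy j A₁ c (u (n * τ) - U n)
      set I := ∫ t in (n * τ)..((n + 1 : ℕ) * τ), ρ t
      set J := ∫ t in (0 : ℝ)..(n * τ), ρ t
      set d := ‖u (n * τ) - U n‖ ^ 2
      have hE0 : 0 ≤ E := le_trans (by positivity) h2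
      -- Coercivity turns the feedback `3τL²d` into `(6L²/μ)τE`, and `1 + x ≤ exp x` absorbs it in
      -- the exponential.
      have h5 : E + τ * (3 * (τ * I + L ^ 2 * d)) ≤
          Real.exp (6 * L ^ 2 / μ * τ) * (E + 3 * τ ^ 2 * I) := by
        have h6 : d ≤ 2 / μ * E := by
          calc d = 2 / μ * (μ / 2 * d) := by field_simp
            _ ≤ _ := mul_le_mul_of_nonneg_left h2 (by positivity)
        have h7 : 3 * τ * L ^ 2 * d ≤ 6 * L ^ 2 / μ * τ * E := by
          calc 3 * τ * L ^ 2 * d ≤ 3 * τ * L ^ 2 * (2 / μ * E) :=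
              mul_le_mul_of_nonneg_left h6 (by positivity)
            _ = _ := by ring
        have h8 : 6 * L ^ 2 / μ * τ + 1 ≤ Real.exp (6 * L ^ 2 / μ * τ) := Real.add_one_le_exp _
        have h9 : 0 ≤ 6 * L ^ 2 / μ * τ := by positivity
        have h10 : 0 ≤ 3 * τ ^ 2 * I := by positivity
        have h11 := mul_le_mul_of_nonneg_right h8 (add_nonneg hE0 h10)
        nlinarith [mul_nonneg h9 h10]
      have h12 : Real.exp (θ * ((n + 1 : ℕ) * τ)) =
          Real.exp (κ * τ) * Real.exp (6 * L ^ 2 / μ * τ) * Real.exp (θ * (n * τ)) := by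
        rw [← Real.exp_add, ← Real.exp_add]
        congr 1
        rw [hθ]
        push_cast
        ring
      have h13 : 1 ≤ Real.exp (θ * (n * τ)) := Real.one_le_exp (by positivity)
      calc _ ≤ Real.exp (κ * τ) * (E + τ * (3 * (τ * I + L ^ 2 * d))) := h1
        _ ≤ Real.exp (κ * τ) * (Real.exp (6 * L ^ 2 / μ * τ) * (E + 3 * τ ^ 2 * I)) := by gcongr
        _ ≤ Real.exp (κ * τ) * (Real.exp (6 * L ^ 2 / μ * τ) *
            (3 * τ ^ 2 * Real.exp (θ * (n * τ)) * J +
              Real.exp (θ * (n * τ)) * (3 * τ ^ 2 * I))) := by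
          -- The new local error is given the accumulated factor too, so that both integrals merge
          -- into one.
          have h14 : 3 * τ ^ 2 * I ≤ Real.exp (θ * (n * τ)) * (3 * τ ^ 2 * I) :=
            le_mul_of_one_le_left (by positivity) h13
          gcongr
        _ = _ := by
          rw [h12]
          ring
  intro n hn
  have h1 := (hcoer _ (hBe n hn)).trans (key n hn)
  rw [norm_sub_rev]
  calc ‖u (n * τ) - U n‖ ^ 2 = 2 / μ * (μ / 2 * ‖u (n * τ) - U n‖ ^ 2) := by field_simp
    _ ≤ 2 / μ * _ := mul_le_mul_of_nonneg_left h1 (by positivity)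
    _ = _ := by ring
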